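/- **Setup.** Units are followed over periods $t=1,\dots,T$. In the population, $t^*\in\{2,\dots,T,\infty\}$ is the period of first treatment ($\infty$ = never treated, and $\mathbb P[t^*=1]=0$), $X$ is a covariate with values in a finite set $\mathcal X$, and $Y_t(\mathbf d)$ is the potential outcome in period $t$ under the treatment path $\mathbf d=(d_1,\dots,d_T)$, $d_t\in\{0,1\}$, $d_t\le d_{t+1}$. Treatment is absorbing, so the observed outcome $Y_t$ is $Y_t(\mathbf d)$ at the path $d_r=\mathbf 1(r\ge t^*)$. Write $Y_t(0)$ for the potential outcome under the zero path, $\tau_t=Y_t-Y_t(0)$ for the unit-level effect, $p_g=\mathbb P[t^*=g]$, $e_g(x)=\mathbb P[t^*=g\mid X=x]$, and $\mathcal S=\{g:p_g>0\}$. Assume: 1. (No anticipation) $Y_t(\mathbf d)$ depends on $\mathbf d$ only through $(d_1,\dots,d_t)$. 2. (Conditional parallel trends) For all $t\ge 2$, $\mathbb E[Y_t(0)-Y_{t-1}(0)\mid t^*,X]=\mathbb E[Y_t(0)-Y_{t-1}(0)\mid X]$ a.s. 3. (Overlap and common support) $p_\infty>0$; there is $\eta>0$ with $e_g(X)<1-\eta$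 a.s. for all $g\in\mathcal S$; and $e_\infty(X)>0$ a.s. 4. (Random sampling) The observations $(Y_{i1},\dots,Y_{iT},t_i^*,X_i)$, $i=1,\dots,n$, are i.i.d. with the law of $(Y_1,\dots,Y_T,t^*,X)$. 5. $\mathbb E[Y_t(\mathbf d)^4\mid t^*=g,X=x]$ is bounded and $\mathbb V[Y_t(\mathbf d)\mid t^*=g,X=x]>0$, for all $t$, $\mathbf d$, and all $g,x$ with $\mathbb P[t^*=g,X=x]>0$. Fix $s\in\mathcal S\setminus\{\infty\}$ and nonrandom period indicators $\lambda_1,\dots,\lambda_T\in\{0,1\}$ with $\lambda_t=1$ for at least one $t\ge s$ and at least one $t<s$. Let $$\Delta\bar Y^s(\lambda)=\frac{\sum_{t\ge s}\lambda_tY_t}{\sum_{t\ge s}\lambda_t}-\frac{\sum_{t<s}\lambda_tY_t}{\sum_{t<s}\lambda_t},\qquad \bar\tau^{\mathsf{post},s}(\lambda)=\frac{\sum_{t\ge s}\lambda_t\tau_t}{\sum_{t\ge s}\lambda_t},$$ let $\sigma^2_\lambda(g,x)=\mathbb V[\Delta\bar Y^s(\lambda)\mid t^*=g,X=x]$ for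 $g\in\{s,\infty\}$, and let $$V_{\mathsf{SEB}}(\lambda)=\mathbb E\left[\frac{\sigma^2_\lambda(s,X)e_s(X)}{p_s^2}+\frac{\left(\mathbb E[\bar\tau^{\mathsf{post},s}(\lambda)\mid t^*=s,X]-\mathbb E[\bar\tau^{\mathsf{post},s}(\lambda)\mid t^*=s]\right)^2e_s(X)}{p_s^2}\right]+\mathbb E\left[\frac{e_s(X)^2\sigma^2_\lambda(\infty,X)}{p_s^2\,e_\infty(X)}\right]$$ be the semiparametric efficiency bound (terms with $e_s(X)=0$ are read as $0$). With $N_s=\sum_i\mathbf 1(t_i^*=s)$ and $\hat e_g(x)=\sum_i\mathbf 1(t_i^*=g)\mathbf 1(X_i=x)/\sum_i\mathbf 1(X_i=x)$, let $$\hat\tau_{\mathsf{disc}}(\lambda)=\frac1{N_s}\sum_{i=1}^n\left(\mathbf 1(t_i^*=s)-\mathbf 1(t_i^*=\infty)\frac{\hat e_s(X_i)}{\hat e_\infty(X_i)}\right)\Delta\bar Y_i^s(\lambda)$$ (with the convention $1/0=0$, which matters only if $N_s=0$). **Proposition.** (a) In every sample in which each unit of cohort $s$ shares its covariate value with at least one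 never-treated unit, $\hat\tau_{\mathsf{disc}}(\lambda)$ equals the exact-matching DiD estimator $$\frac1{N_s}\sum_{i:\,t_i^*=s}\left(\Delta\bar Y_i^s(\lambda)-\frac{1}{\#\mathcal J(i)}\sum_{j\in\mathcal J(i)}\Delta\bar Y_j^s(\lambda)\right),\qquad \mathcal J(i)=\{j\le n:t_j^*=\infty,\ X_j=X_i\}.$$ (b) $V_{\mathsf{SEB}}(\lambda)\ge0$ and, as $n\to\infty$, $$\sqrt n\left(\hat\tau_{\mathsf{disc}}(\lambda)-\mathbb E[\bar\tau^{\mathsf{post},s}(\lambda)\mid t^*=s]\right)\to_{\mathcal D}\mathcal N\left(0,V_{\mathsf{SEB}}(\lambda)\right).$$ -/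

import Mathlib

open MeasureTheory ProbabilityTheory Filter Topology

noncomputable section

namespace DiscreteDiD

/-- Treatment cohorts, i.e. values of the first treatment date. The `T` periods are indexed by
`Fin T` (its least element is the first period), and `⊤` is the never-treated cohort `∞`. -/
abbrev Cohort (T : ℕ) := WithTop (Fin T)

/-- Treatment paths `(d_1, …, d_T)` with `d_t ∈ {0, 1}` and `d_t ≤ d_{t+1}`. -/
abbrev Path (T : ℕ) := Fin T →o Bool

/-- The path of a unit first treated in period `g`: zero before `g` and one from `g` on.
For `g = ⊤` it is the zero path. -/
def cohortPath {T : ℕ} (g : Cohort T) : Path T where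
  toFun t := decide (g ≤ (t : Cohort T))
  monotone' := by
    intro a b hab
    by_cases h : g ≤ (a : Cohort T)
    · have h2 : g ≤ (b : Cohort T) := h.trans (WithTop.coe_le_coe.2 hab)
      simp [h, h2]
    · simp [h]

/-- What is observed on a unit: its outcomes, its cohort and its covariates. -/
abbrev Obs (T : ℕ) (𝒳 : Type*) := (Fin T → ℝ) × Cohort T × 𝒳

/-- A population: the potential outcomes `Y_t(d)`, the first treatment date `t*` and the
covariates `X`, as random variables. -/
structure Population (T : ℕ) (𝒳 Ω : Type*) [MeasurableSpace 𝒳] [MeasurableSpace Ω] where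
  Y : Fin T → Path T → Ω → ℝ
  cohort : Ω → Cohort T
  X : Ω → 𝒳
  measurable_Y : ∀ t d, Measurable (Y t d)
  measurable_cohort : Measurable cohort
  measurable_X : Measurable X

/-- Average of the outcomes `y` over the included periods `t ≥ s`. -/
def postAvg {T : ℕ} (lam : Fin T → ℝ) (s : Fin T) (y : Fin T → ℝ) : ℝ :=
  (∑ t with s ≤ t, lam t * y t) / ∑ t with s ≤ t, lam t

/-- Average of the outcomes `y` over the included periods `t < s`. -/
def preAvg {T : ℕ} (lam : Fin T → ℝ) (s : Fin T) (y : Fin T → ℝ) : ℝ :=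
  (∑ t with t < s, lam t * y t) / ∑ t with t < s, lam t

/-- `ΔȲ^s(λ)`: post-treatment average minus pre-treatment average. -/
def deltaY {T : ℕ} (lam : Fin T → ℝ) (s : Fin T) (y : Fin T → ℝ) : ℝ :=
  postAvg lam s y - preAvg lam s y

namespace Population

variable {T : ℕ} {𝒳 Ω : Type*} [MeasurableSpace 𝒳] [MeasurableSpace Ω]

/-- The untreated potential outcome `Y_t(0)`. -/
def Y0 (pop : Population T 𝒳 Ω) (t : Fin T) (ω : Ω) : ℝ :=
  pop.Y t (cohortPath ⊤) ω

/-- The observed outcome: the potential outcome at the realized treatment path. -/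
def Yobs (pop : Population T 𝒳 Ω) (t : Fin T) (ω : Ω) : ℝ :=
  pop.Y t (cohortPath (pop.cohort ω)) ω

/-- The observed vector `(Y_1, …, Y_T, t*, X)`. -/
def obs (pop : Population T 𝒳 Ω) (ω : Ω) : Obs T 𝒳 :=
  (fun t => pop.Yobs t ω, pop.cohort ω, pop.X ω)

/-- The unit-level treatment effect `τ_t = Y_t(t*) - Y_t(0)`. -/
def tau (pop : Population T 𝒳 Ω) (t : Fin T) (ω : Ω) : ℝ :=
  pop.Y t (cohortPath (pop.cohort ω)) ω - pop.Y0 t ω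

/-- The unit-level average treatment effect over the included periods `t ≥ s`. -/
def tauPost (pop : Population T 𝒳 Ω) (lam : Fin T → ℝ) (s : Fin T) (ω : Ω) : ℝ :=
  postAvg lam s (fun t => pop.tau t ω)

/-- `ΔȲ^s(λ)` as a random variable. -/
def DeltaY (pop : Population T 𝒳 Ω) (lam : Fin T → ℝ) (s : Fin T) (ω : Ω) : ℝ :=
  deltaY lam s (fun t => pop.Yobs t ω)

/-- The event `{t* = g}`. -/
def cohortEvent (pop : Population T 𝒳 Ω) (g : Cohort T) : Set Ω := {ω | pop.cohort ω = g}

/-- The event `{t* = g, X = x}`. -/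
def cell (pop : Population T 𝒳 Ω) (g : Cohort T) (x : 𝒳) : Set Ω :=
  {ω | pop.cohort ω = g ∧ pop.X ω = x}

/-- `p_g = P[t* = g]`. -/
def p (pop : Population T 𝒳 Ω) (P : Measure Ω) (g : Cohort T) : ℝ :=
  P.real (pop.cohortEvent g)

/-- The propensity score `e_g(x) = P[t* = g | X = x]`. -/
def e (pop : Population T 𝒳 Ω) (P : Measure Ω) (g : Cohort T) (x : 𝒳) : ℝ :=
  (P[|{ω | pop.X ω = x}]).real (pop.cohortEvent g)

/-- `σ²_λ(g, x) = V[ΔȲ^s(λ) | t* = g, X = x]`. -/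
def sigmaSq (pop : Population T 𝒳 Ω) (P : Measure Ω) (lam : Fin T → ℝ) (s : Fin T)
    (g : Cohort T) (x : 𝒳) : ℝ :=
  variance (pop.DeltaY lam s) (P[|pop.cell g x])

/-- `E[τ̄^{post,s}(λ) | t* = s]`. -/
def att (pop : Population T 𝒳 Ω) (P : Measure Ω) (lam : Fin T → ℝ) (s : Fin T) : ℝ :=
  ∫ ω, pop.tauPost lam s ω ∂P[|pop.cohortEvent s]

/-- `E[τ̄^{post,s}(λ) | t* = s, X = x]`. -/
def catt (pop : Population T 𝒳 Ω) (P : Measure Ω) (lam : Fin T → ℝ) (s : Fin T) (x : 𝒳) : ℝ :=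
  ∫ ω, pop.tauPost lam s ω ∂P[|pop.cell s x]

/-- The semiparametric efficiency bound for comparing cohort `s` with the never-treated. -/
def VSEB (pop : Population T 𝒳 Ω) (P : Measure Ω) (lam : Fin T → ℝ) (s : Fin T) : ℝ :=
  (∫ ω, (pop.sigmaSq P lam s s (pop.X ω) * pop.e P s (pop.X ω) / pop.p P s ^ 2
      + (pop.catt P lam s (pop.X ω) - pop.att P lam s) ^ 2 * pop.e P s (pop.X ω)
        / pop.p P s ^ 2) ∂P)
  + ∫ ω, pop.e P s (pop.X ω) ^ 2 * pop.sigmaSq P lam s ⊤ (pop.X ω)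
      / (pop.p P s ^ 2 * pop.e P ⊤ (pop.X ω)) ∂P

/-- There is a pure pre-treatment period: no unit is treated in the first period. -/
def NoneTreatedFirst (pop : Population T 𝒳 Ω) (P : Measure Ω) : Prop :=
  ∀ t : Fin T, t.val = 0 → P (pop.cohortEvent t) = 0

/-- No treatment anticipation: `Y_t(d)` depends on `d` only through `(d_1, …, d_t)`. -/
def NoAnticipation (pop : Population T 𝒳 Ω) (P : Measure Ω) : Prop :=
  ∀ (t : Fin T) (d d' : Path T), (∀ r ≤ t, d r = d' r) → pop.Y t d =ᵐ[P] pop.Y t d'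

/-- Conditional parallel trends: for consecutive periods `t' = t - 1` and `t`,
`E[Y_t(0) - Y_{t-1}(0) | t*, X] = E[Y_t(0) - Y_{t-1}(0) | X]` almost surely. -/
def ParallelTrends (pop : Population T 𝒳 Ω) (P : Measure Ω) : Prop :=
  ∀ t' t : Fin T, t'.val + 1 = t.val →
    P[fun ω => pop.Y0 t ω - pop.Y0 t' ω |
        MeasurableSpace.comap (fun ω => (pop.cohort ω, pop.X ω)) inferInstance]
      =ᵐ[P]
    P[fun ω => pop.Y0 t ω - pop.Y0 t' ω | MeasurableSpace.comap pop.X inferInstance]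

/-- Overlap: a non-zero mass of never-treated units, propensity scores bounded away from one
over all cohorts of positive probability, and common support (`e_∞(X) > 0`). -/
def Overlap (pop : Population T 𝒳 Ω) (P : Measure Ω) : Prop :=
  0 < pop.p P ⊤ ∧
  (∃ η : ℝ, 0 < η ∧ ∀ g : Cohort T, 0 < pop.p P g → ∀ᵐ ω ∂P, pop.e P g (pop.X ω) < 1 - η) ∧
  ∀ᵐ ω ∂P, 0 < pop.e P ⊤ (pop.X ω)

/-- The conditional fourth moments of all potential outcomes are bounded. -/
def BoundedFourthMoments (pop : Population T 𝒳 Ω) (P : Measure Ω) : Prop :=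
  ∃ C : NNReal, ∀ (t : Fin T) (d : Path T) (g : Cohort T) (x : 𝒳), P (pop.cell g x) ≠ 0 →
    ∫⁻ ω, ENNReal.ofReal (pop.Y t d ω ^ 4) ∂P[|pop.cell g x] ≤ C

/-- The conditional variances of all potential outcomes are positive. -/
def PositiveVariances (pop : Population T 𝒳 Ω) (P : Measure Ω) : Prop :=
  ∀ (t : Fin T) (d : Path T) (g : Cohort T) (x : 𝒳), P (pop.cell g x) ≠ 0 →
    0 < variance (pop.Y t d) (P[|pop.cell g x])

/-- Random sampling: the `W i` are independent, each distributed as `(Y_1, …, Y_T, t*, X)`. -/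
def IsRandomSample (pop : Population T 𝒳 Ω) (P : Measure Ω) {Ω' : Type*} [MeasurableSpace Ω']
    (P' : Measure Ω') (W : ℕ → Ω' → Obs T 𝒳) : Prop :=
  iIndepFun W P' ∧ ∀ i, IdentDistrib (W i) pop.obs P' P

end Population

section Estimator

variable {T : ℕ} {𝒳 : Type*} [DecidableEq 𝒳]

/-- `N_g`: the number of units of cohort `g` among the first `n` units of the data `w`. -/
def cohortCount (w : ℕ → Obs T 𝒳) (n : ℕ) (g : Cohort T) : ℝ :=
  ∑ i ∈ Finset.range n, if (w i).2.1 = g then 1 else 0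

/-- The estimated propensity score `ê_g(x)`. -/
def eHat (w : ℕ → Obs T 𝒳) (n : ℕ) (g : Cohort T) (x : 𝒳) : ℝ :=
  (∑ i ∈ Finset.range n, (if (w i).2.1 = g then 1 else 0) * (if (w i).2.2 = x then 1 else 0))
    / ∑ i ∈ Finset.range n, if (w i).2.2 = x then 1 else 0

/-- The estimator `τ̂_disc(λ)`, which reweights the never-treated units by `ê_s / ê_∞`. -/
def tauDisc (w : ℕ → Obs T 𝒳) (n : ℕ) (lam : Fin T → ℝ) (s : Fin T) : ℝ :=
  1 / cohortCount w n s *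
    ∑ i ∈ Finset.range n,
      ((if (w i).2.1 = (s : Cohort T) then 1 else 0)
        - (if (w i).2.1 = ⊤ then 1 else 0)
            * (eHat w n s (w i).2.2 / eHat w n ⊤ (w i).2.2))
        * deltaY lam s (w i).1

/-- The exact matches of unit `i`: all never-treated units with the same covariates. -/
def exactMatches (w : ℕ → Obs T 𝒳) (n i : ℕ) : Finset ℕ :=
  {j ∈ Finset.range n | (w j).2.1 = ⊤ ∧ (w j).2.2 = (w i).2.2}

/-- The exact-matching DiD estimator: the average over the units of cohort `s` of `ΔȲ^s(λ)` minus
the mean of `ΔȲ^s(λ)` over the exact matches of the unit. -/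
def tauExactMatch (w : ℕ → Obs T 𝒳) (n : ℕ) (lam : Fin T → ℝ) (s : Fin T) : ℝ :=
  1 / cohortCount w n s *
    ∑ i ∈ Finset.range n with (w i).2.1 = (s : Cohort T),
      (deltaY lam s (w i).1
        - (∑ j ∈ exactMatches w n i, deltaY lam s (w j).1) / (exactMatches w n i).card)

end Estimator

end DiscreteDiD

end

/-! Write `m x` for the mean of ΔȲ among never-treated units with X = x, and θ for the ATT. The
covariate is discrete, so `ê_s / ê_∞` at a sample point is the ratio of cell counts N_{s,x} /
N_{∞,x}. Grouping units by covariate value then gives (a): both estimators subtract, for each x,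
N_{s,x} times the never-treated mean of that cell.

For (b), reweighting the never-treated reproduces ∑ₓ m x · N_{s,x} exactly, so `m` can be subtracted
from both groups at no cost (`tauDisc_sub_eq`). The error becomes a combination of centred i.i.d.
sums: one over cohort s, one over each never-treated cell. The treated sum is centred by
identification (`integral_DeltaY_cell`): no anticipation and parallel trends make the two cell means
of ΔȲ differ by the conditional ATT.

The random coefficients n / N_s and N_{s,x} / N_{∞,x} converge almost surely, while the scaled sums
converge in law. By Slutsky the coefficients may be replaced by their limits, so estimating the
propensity scores leaves only a negligible remainder. What is left is the normalised sum of
`influence`, to which the CLT applies; its second moment is `VSEB` (`integral_influence_sq`),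
because treated and never-treated contributions have product zero. -/

namespace DiscreteDiD

/-! ### Slutsky-type lemmas. -/

section Slutsky

variable {Ω : Type*} [MeasurableSpace Ω] {P : Measure Ω} [IsProbabilityMeasure P]
  {Ω₁ : Type*} [MeasurableSpace Ω₁] {Q : Measure Ω₁} [IsProbabilityMeasure Q]

/-- Convergence in distribution to zero implies convergence in probability to zero. -/
theorem tendstoInMeasure_zero_of_tendstoInDistribution {X : ℕ → Ω → ℝ}
    (h : TendstoInDistribution X atTop (fun _ : Ω₁ => (0 : ℝ)) (fun _ => P) Q) :
    TendstoInMeasure P X atTop (fun _ => 0) := by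
  rw [tendstoInMeasure_iff_norm]
  intro ε hε
  have hclosed : IsClosed {x : ℝ | ε ≤ ‖x‖} := isClosed_le continuous_const continuous_norm
  have hfr : frontier {x : ℝ | ε ≤ ‖x‖} ⊆ {x | ε = ‖x‖} :=
    frontier_le_subset_eq continuous_const continuous_norm
  have hmap : Q.map (fun _ : Ω₁ => (0 : ℝ)) = Measure.dirac 0 := by simp
  -- Portmanteau: the frontier lies in {‖x‖ = ε}, which the Dirac mass at 0 does not charge.
  have key := ProbabilityMeasure.tendsto_measure_of_null_frontier_of_tendsto' h.tendsto
    (E := {x : ℝ | ε ≤ ‖x‖}) (by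
      simp only [ProbabilityMeasure.coe_mk, hmap]
      rw [Measure.dirac_apply' _ isClosed_frontier.measurableSet, Set.indicator_of_notMem]
      intro h0
      have := hfr h0
      simp at this
      exact hε.ne' this)
  simp only [ProbabilityMeasure.coe_mk, hmap] at key
  rw [Measure.dirac_apply' _ hclosed.measurableSet, Set.indicator_of_notMem (by simpa using hε)]
    at key
  refine key.congr fun n => ?_
  rw [Measure.map_apply_of_aemeasurable (h.forall_aemeasurable n) hclosed.measurableSet]
  simp

/-- The product of a sequence that vanishes almost surely and of a sequence that converges in
distribution vanishes in probability. -/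
theorem tendstoInMeasure_mul_of_tendstoInDistribution {A Z : ℕ → Ω → ℝ} {Y : Ω₁ → ℝ}
    (hA : ∀ n, AEMeasurable (A n) P) (hA0 : ∀ᵐ ω ∂P, Tendsto (fun n => A n ω) atTop (𝓝 0))
    (hZ : TendstoInDistribution Z atTop Y (fun _ => P) Q) :
    TendstoInMeasure P (fun n ω => A n ω * Z n ω) atTop (fun _ => 0) := by
  apply tendstoInMeasure_zero_of_tendstoInDistribution (Q := Q)
  -- The limit law is that of 0 · Y, a constant, so convergence in law upgrades to convergence in
  -- probability.
  have := hZ.continuous_comp_prodMk_of_tendstoInMeasure_const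
    (g := fun q : ℝ × ℝ => q.2 * q.1) (by fun_prop)
    (tendstoInMeasure_of_tendsto_ae (fun n => (hA n).aestronglyMeasurable) hA0) hA
  simpa using this

/-- Adding finitely many asymptotically negligible products does not change a limit in
distribution. -/
theorem tendstoInDistribution_add_sum_mul {ι : Type*} (J : Finset ι) {X : ℕ → Ω → ℝ}
    {A Z : ι → ℕ → Ω → ℝ} {L : Ω₁ → ℝ}
    (hX : TendstoInDistribution X atTop L (fun _ => P) Q)
    (hA : ∀ j n, AEMeasurable (A j n) P)
    (hA0 : ∀ j, ∀ᵐ ω ∂P, Tendsto (fun n => A j n ω) atTop (𝓝 0))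
    (hZ : ∀ j, ∃ v, TendstoInDistribution (Z j) atTop (id : ℝ → ℝ) (fun _ => P)
      (gaussianReal 0 v)) :
    TendstoInDistribution (fun n ω => X n ω + ∑ j ∈ J, A j n ω * Z j n ω) atTop L
      (fun _ => P) Q := by
  classical
  induction J using Finset.induction_on with
  | empty => simpa using hX
  | insert j J hj ih =>
    obtain ⟨v, hv⟩ := hZ j
    have h := ih.add_of_tendstoInMeasure_const
      (tendstoInMeasure_mul_of_tendstoInDistribution (hA j) (hA0 j) hv)
      (fun n => (hA j n).mul (hv.forall_aemeasurable n))
    refine TendstoInDistribution.congr (fun n => ?_) ?_ h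
    · refine Eventually.of_forall fun ω => ?_
      simp only [Pi.add_apply, Finset.sum_insert hj]
      ring
    · simp

/-- A sequence that almost surely eventually agrees with one converging in distribution has the
same limit. -/
theorem tendstoInDistribution_of_ae_eventually_eq {X Y : ℕ → Ω → ℝ} {L : Ω₁ → ℝ}
    (hX : TendstoInDistribution X atTop L (fun _ => P) Q)
    (hY : ∀ n, AEMeasurable (Y n) P) (h : ∀ᵐ ω ∂P, ∀ᶠ n in atTop, Y n ω = X n ω) :
    TendstoInDistribution Y atTop L (fun _ => P) Q := by
  refine tendstoInDistribution_of_tendstoInMeasure_sub Y L hX ?_ hY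
  refine tendstoInMeasure_of_tendsto_ae
    (fun n => ((hY n).sub (hX.forall_aemeasurable n)).aestronglyMeasurable) ?_
  filter_upwards [h] with ω hω
  refine tendsto_const_nhds.congr' ?_
  filter_upwards [hω] with n hn
  simp [hn]

end Slutsky

/-! ### Law of large numbers and CLT for functions of the sample. -/

section Sampling

variable {Ω : Type*} [MeasurableSpace Ω] {P : Measure Ω} {Ω' : Type*} [MeasurableSpace Ω']
  {P' : Measure Ω'}
  {E : Type*} [MeasurableSpace E] {W : ℕ → Ω' → E} {V : Ω → E}

theorem ae_tendsto_sample_mean (hW : iIndepFun W P') (hV : ∀ i, IdentDistrib (W i) V P' P)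
    {f : E → ℝ} (hf : Measurable f) (hint : Integrable (fun ω => f (V ω)) P) :
    ∀ᵐ ω ∂P', Tendsto (fun n : ℕ => (n : ℝ)⁻¹ * ∑ i ∈ Finset.range n, f (W i ω)) atTop
      (𝓝 (∫ ω, f (V ω) ∂P)) := by
  have hid (i : ℕ) : IdentDistrib (fun ω => f (W i ω)) (fun ω => f (V ω)) P' P := (hV i).comp hf
  have := strong_law_ae (μ := P') (fun i ω => f (W i ω)) ((hid 0).integrable_iff.2 hint)
    (fun i j hij => (hW.comp (fun _ => f) (fun _ => hf)).indepFun hij)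
    (fun i => (hid i).trans (hid 0).symm)
  rw [(hid 0).integral_eq] at this
  simpa using this

theorem tendstoInDistribution_sample_sum [IsProbabilityMeasure P'] (hW : iIndepFun W P')
    (hV : ∀ i, IdentDistrib (W i) V P' P) {f : E → ℝ} (hf : Measurable f)
    (hL2 : MemLp (fun ω => f (V ω)) 2 P) (hmean : ∫ ω, f (V ω) ∂P = 0) :
    TendstoInDistribution (fun (n : ℕ) ω => (√n)⁻¹ * ∑ i ∈ Finset.range n, f (W i ω)) atTop
      (id : ℝ → ℝ) (fun _ => P')
      (gaussianReal 0 (variance (fun ω => f (V ω)) P).toNNReal) := by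
  have hid (i : ℕ) : IdentDistrib (fun ω => f (W i ω)) (fun ω => f (V ω)) P' P := (hV i).comp hf
  have h := tendstoInDistribution_inv_sqrt_mul_sum_sub (P := P')
    (P' := gaussianReal 0 (variance (fun ω => f (V ω)) P).toNNReal)
    (X := fun i ω => f (W i ω)) (Y := (id : ℝ → ℝ))
    ⟨by fun_prop, by rw [(hid 0).variance_eq]; simp⟩ ((hid 0).memLp_iff.2 hL2)
    (hW.comp (fun _ => f) (fun _ => hf)) (fun i => (hid i).trans (hid 0).symm)
  rw [(hid 0).integral_eq, hmean] at h
  simpa using h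

end Sampling

/-! ### Finite-sample algebra of the estimator. -/

section EstimatorAlgebra

variable {T : ℕ} {𝒳 : Type*} [DecidableEq 𝒳]

/-- The number of units with cohort `g` and covariate value `x`. -/
noncomputable def cellCount (w : ℕ → Obs T 𝒳) (n : ℕ) (g : Cohort T) (x : 𝒳) : ℝ :=
  ∑ i ∈ Finset.range n, (if (w i).2.1 = g then 1 else 0) * (if (w i).2.2 = x then 1 else 0)

/-- Unit `i` itself has the covariate value in question, so the common denominator is nonzero and
cancels. -/
theorem eHat_div_eHat (w : ℕ → Obs T 𝒳) {n i : ℕ} (hi : i < n) (g g' : Cohort T) :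
    eHat w n g (w i).2.2 / eHat w n g' (w i).2.2
      = cellCount w n g (w i).2.2 / cellCount w n g' (w i).2.2 := by
  have h : (∑ j ∈ Finset.range n, if (w j).2.2 = (w i).2.2 then (1 : ℝ) else 0) ≠ 0 := by
    refine (lt_of_lt_of_le one_pos ?_).ne'
    have := Finset.single_le_sum (s := Finset.range n)
      (f := fun j => if (w j).2.2 = (w i).2.2 then (1 : ℝ) else 0)
      (fun j _ => by positivity) (Finset.mem_range.2 hi)
    simpa using this
  exact div_div_div_cancel_right₀ h _ _

theorem sum_mul_comp_covariate [Fintype 𝒳] (w : ℕ → Obs T 𝒳) (n : ℕ) (a : ℕ → ℝ) (F : 𝒳 → ℝ) :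
    ∑ i ∈ Finset.range n, a i * F (w i).2.2
      = ∑ x, F x * ∑ i ∈ Finset.range n, a i * (if (w i).2.2 = x then 1 else 0) := by
  simp_rw [Finset.mul_sum]
  rw [Finset.sum_comm]
  refine Finset.sum_congr rfl fun i _ => ?_
  simp [mul_comm]

theorem tauDisc_eq (w : ℕ → Obs T 𝒳) (n : ℕ) (lam : Fin T → ℝ) (s : Fin T) :
    tauDisc w n lam s = 1 / cohortCount w n s *
      (∑ i ∈ Finset.range n, (if (w i).2.1 = (s : Cohort T) then 1 else 0) * deltaY lam s (w i).1
        - ∑ i ∈ Finset.range n, ((if (w i).2.1 = ⊤ then 1 else 0) * deltaY lam s (w i).1)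
            * (cellCount w n s (w i).2.2 / cellCount w n ⊤ (w i).2.2)) := by
  rw [tauDisc, ← Finset.sum_sub_distrib]
  congr 1
  refine Finset.sum_congr rfl fun i hi => ?_
  rw [eHat_div_eHat w (Finset.mem_range.1 hi)]
  ring

/-- The estimation error in terms of centred sums over the cohort and over the never-treated cells. -/
theorem tauDisc_sub_eq [Fintype 𝒳] (w : ℕ → Obs T 𝒳) (n : ℕ) (lam : Fin T → ℝ)
    (s : Fin T) (m : 𝒳 → ℝ) (θ : ℝ) (hs : cohortCount w n s ≠ 0)
    (hx : ∀ x, cellCount w n ⊤ x = 0 → cellCount w n s x = 0) :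
    tauDisc w n lam s - θ = 1 / cohortCount w n s *
      (∑ i ∈ Finset.range n, (if (w i).2.1 = (s : Cohort T) then 1 else 0)
          * (deltaY lam s (w i).1 - m (w i).2.2 - θ)
        - ∑ x, cellCount w n s x / cellCount w n ⊤ x *
            ∑ i ∈ Finset.range n, (if (w i).2.1 = ⊤ then 1 else 0)
              * (if (w i).2.2 = x then 1 else 0) * (deltaY lam s (w i).1 - m x)) := by
  have h1 : ∑ i ∈ Finset.range n, (if (w i).2.1 = (s : Cohort T) then (1 : ℝ) else 0)
        * (deltaY lam s (w i).1 - m (w i).2.2 - θ)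
      = ∑ i ∈ Finset.range n, (if (w i).2.1 = (s : Cohort T) then 1 else 0) * deltaY lam s (w i).1
        - ∑ x, m x * cellCount w n s x - cohortCount w n s * θ := by
    simp only [cellCount, ← sum_mul_comp_covariate, cohortCount, Finset.sum_mul, mul_sub,
      Finset.sum_sub_distrib]
  have h2 : ∑ x, cellCount w n s x / cellCount w n ⊤ x *
            ∑ i ∈ Finset.range n, (if (w i).2.1 = ⊤ then (1 : ℝ) else 0)
              * (if (w i).2.2 = x then 1 else 0) * (deltaY lam s (w i).1 - m x)
      = ∑ i ∈ Finset.range n, ((if (w i).2.1 = ⊤ then 1 else 0) * deltaY lam s (w i).1)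
            * (cellCount w n s (w i).2.2 / cellCount w n ⊤ (w i).2.2)
        - ∑ x, m x * cellCount w n s x := by
    rw [sum_mul_comp_covariate w n _ (fun x => cellCount w n s x / cellCount w n ⊤ x),
      ← Finset.sum_sub_distrib]
    refine Finset.sum_congr rfl fun x _ => ?_
    -- The reweighted never-treated count of a cell is its cohort-s count; `hx` covers cells without
    -- never-treated units, where both sides are 0.
    have : m x * cellCount w n s x
        = cellCount w n s x / cellCount w n ⊤ x * (cellCount w n ⊤ x * m x) := by
      by_cases h : cellCount w n ⊤ x = 0
      · simp [h, hx x h]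
      · field_simp
    rw [this, ← mul_sub]
    congr 1
    conv_rhs => rw [cellCount, Finset.sum_mul, ← Finset.sum_sub_distrib]
    refine Finset.sum_congr rfl fun i _ => ?_
    ring
  rw [h1, h2, tauDisc_eq]
  field_simp
  ring

theorem card_exactMatches (w : ℕ → Obs T 𝒳) (n i : ℕ) :
    ((exactMatches w n i).card : ℝ) = cellCount w n ⊤ (w i).2.2 := by
  rw [exactMatches, Finset.card_filter, Nat.cast_sum, cellCount]
  refine Finset.sum_congr rfl fun j _ => ?_
  by_cases h1 : (w j).2.1 = ⊤ <;> by_cases h2 : (w j).2.2 = (w i).2.2 <;> simp [h1, h2]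

/-- All treated units of a cell share the same matches, so exchanging the sums over units and
matches leaves one sum over cells. In a cell without never-treated units both control terms are 0,
since `a / 0 = 0`. -/
theorem tauDisc_eq_tauExactMatch [Fintype 𝒳] (w : ℕ → Obs T 𝒳) (n : ℕ) (lam : Fin T → ℝ)
    (s : Fin T) : tauDisc w n lam s = tauExactMatch w n lam s := by
  rw [tauDisc_eq, tauExactMatch, Finset.sum_sub_distrib]
  congr 2
  · simp [Finset.sum_filter]
  · simp_rw [card_exactMatches, Finset.sum_filter]
    rw [sum_mul_comp_covariate w n _ (fun x => cellCount w n s x / cellCount w n ⊤ x)]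
    -- `F x` is the mean of ΔȲ over the never-treated units of cell x.
    obtain ⟨F, hF⟩ : ∃ F : 𝒳 → ℝ, F = fun x => (∑ j ∈ Finset.range n,
        (if (w j).2.1 = ⊤ then 1 else 0) * deltaY lam s (w j).1
          * (if (w j).2.2 = x then 1 else 0)) / cellCount w n ⊤ x := ⟨_, rfl⟩
    have h (i : ℕ) : (if (w i).2.1 = (s : Cohort T) then
          (∑ j ∈ exactMatches w n i, deltaY lam s (w j).1) / cellCount w n ⊤ (w i).2.2 else 0)
        = (if (w i).2.1 = (s : Cohort T) then 1 else 0) * F (w i).2.2 := by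
      rw [ite_mul, one_mul, zero_mul, hF]
      congr 2
      rw [exactMatches, Finset.sum_filter]
      refine Finset.sum_congr rfl fun j _ => ?_
      by_cases h1 : (w j).2.1 = ⊤ <;> by_cases h2 : (w j).2.2 = (w i).2.2 <;> simp [h1, h2]
    rw [Finset.sum_congr rfl fun i _ => h i, sum_mul_comp_covariate, hF]
    refine Finset.sum_congr rfl fun x _ => ?_
    rw [← cellCount]
    ring

end EstimatorAlgebra

/-! ### Integrals under conditioning on an event. -/

section CondIntegral

variable {Ω : Type*} [MeasurableSpace Ω] {P : Measure Ω} [IsProbabilityMeasure P]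

/-- Both sides vanish when `A` is null, which lets later sums run over all cells, null ones
included. -/
theorem setIntegral_eq_measureReal_mul_cond (A : Set Ω) (f : Ω → ℝ) :
    ∫ ω in A, f ω ∂P = P.real A * ∫ ω, f ω ∂P[|A] := by
  rw [ProbabilityTheory.cond, integral_smul_measure, smul_eq_mul, ← mul_assoc]
  by_cases h : P A = 0
  · simp [Measure.restrict_eq_zero.2 h]
  · have h' : P.real A ≠ 0 := (measureReal_ne_zero_iff).2 h
    rw [ENNReal.toReal_inv, ← measureReal_def, mul_inv_cancel₀ h', one_mul]

omit [IsProbabilityMeasure P] in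
theorem memLp_cond {f : Ω → ℝ} {q : ENNReal} (hf : MemLp f q P) {A : Set Ω} (hA : P A ≠ 0) :
    MemLp f q P[|A] :=
  (hf.restrict A).smul_measure (ENNReal.inv_ne_top.2 hA)

omit [IsProbabilityMeasure P] in
theorem ae_cond_of_ae {p : Ω → Prop} (h : ∀ᵐ ω ∂P, p ω) (A : Set Ω) : ∀ᵐ ω ∂P[|A], p ω :=
  cond_absolutelyContinuous.ae_le h

theorem integral_sub_const_sq {Q : Measure Ω} [IsProbabilityMeasure Q] {f : Ω → ℝ}
    (hf : MemLp f 2 Q) (c : ℝ) :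
    ∫ ω, (f ω - c) ^ 2 ∂Q = variance f Q + (∫ ω, f ω ∂Q - c) ^ 2 := by
  have h1 := hf.integrable one_le_two
  have h2 := hf.integrable_sq
  rw [variance_eq_sub hf]
  simp only [sub_sq, Pi.pow_apply]
  rw [integral_add (by fun_prop) (by fun_prop), integral_sub (by fun_prop) (by fun_prop),
    integral_mul_const, integral_const_mul]
  simp
  ring

end CondIntegral

/-! ### ΔȲ as a weighted sum over periods. -/

section Weights

variable {T : ℕ}

/-- The weight of period `t` in `postAvg`. -/
noncomputable def postWeight (lam : Fin T → ℝ) (s t : Fin T) : ℝ :=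
  (if s ≤ t then lam t else 0) / ∑ t with s ≤ t, lam t

/-- The weight of period `t` in `preAvg`. -/
noncomputable def preWeight (lam : Fin T → ℝ) (s t : Fin T) : ℝ :=
  (if t < s then lam t else 0) / ∑ t with t < s, lam t

theorem postAvg_eq_sum (lam : Fin T → ℝ) (s : Fin T) (y : Fin T → ℝ) :
    postAvg lam s y = ∑ t, postWeight lam s t * y t := by
  simp only [postAvg, postWeight, Finset.sum_filter, Finset.sum_div]
  refine Finset.sum_congr rfl fun t _ => ?_
  split_ifs <;> ring

theorem preAvg_eq_sum (lam : Fin T → ℝ) (s : Fin T) (y : Fin T → ℝ) :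
    preAvg lam s y = ∑ t, preWeight lam s t * y t := by
  simp only [preAvg, preWeight, Finset.sum_filter, Finset.sum_div]
  refine Finset.sum_congr rfl fun t _ => ?_
  split_ifs <;> ring

theorem deltaY_eq_sum (lam : Fin T → ℝ) (s : Fin T) (y : Fin T → ℝ) :
    deltaY lam s y = ∑ t, (postWeight lam s t - preWeight lam s t) * y t := by
  simp only [deltaY, postAvg_eq_sum, preAvg_eq_sum, sub_mul, Finset.sum_sub_distrib]

theorem measurable_deltaY (lam : Fin T → ℝ) (s : Fin T) : Measurable (deltaY lam s) := by
  have : deltaY lam s = fun y => ∑ t, (postWeight lam s t - preWeight lam s t) * y t :=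
    funext (deltaY_eq_sum lam s)
  rw [this]
  fun_prop

theorem sum_ne_zero_of_mem {lam : Fin T → ℝ} (hlam : ∀ t, lam t = 0 ∨ lam t = 1)
    {A : Finset (Fin T)} {t : Fin T} (ht : t ∈ A) (h1 : lam t = 1) : ∑ t ∈ A, lam t ≠ 0 := by
  have h0 : ∀ t ∈ A, 0 ≤ lam t := fun t _ => by rcases hlam t with h | h <;> simp [h]
  have := Finset.single_le_sum h0 ht
  linarith

/-- Post and pre weights each sum to one. Hence ΔȲ removes anything constant over time. -/
theorem sum_deltaWeight {lam : Fin T → ℝ} {s : Fin T} (hlam : ∀ t, lam t = 0 ∨ lam t = 1)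
    (hpost : ∃ t, s ≤ t ∧ lam t = 1) (hpre : ∃ t, t < s ∧ lam t = 1) :
    ∑ t, (postWeight lam s t - preWeight lam s t) = 0 := by
  obtain ⟨t, ht, h1⟩ := hpost
  obtain ⟨t', ht', h1'⟩ := hpre
  rw [Finset.sum_sub_distrib]
  simp only [postWeight, preWeight, ← Finset.sum_div, ← Finset.sum_filter]
  rw [div_self (sum_ne_zero_of_mem hlam (by simpa using ht) h1),
    div_self (sum_ne_zero_of_mem hlam (by simpa using ht') h1'), sub_self]

/-- Passes from parallel trends between consecutive periods to a cohort gap constant over all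
periods. -/
theorem eq_of_succ_eq {f : Fin T → ℝ} (h : ∀ t' t : Fin T, t'.val + 1 = t.val → f t = f t')
    (a b : Fin T) : f a = f b := by
  have key : ∀ (n : ℕ) (hn : n < T), f ⟨n, hn⟩ = f ⟨0, by omega⟩ := by
    intro n
    induction n with
    | zero => intro _; rfl
    | succ k ih => intro hn; rw [h ⟨k, by omega⟩ ⟨k + 1, hn⟩ rfl, ih]
  rw [← Fin.eta a a.2, ← Fin.eta b b.2, key, key b]

end Weights

/-! ### Measurability, propensity scores and common support. -/

namespace Population

variable {T : ℕ} {𝒳 Ω : Type*} [MeasurableSpace 𝒳] [MeasurableSpace Ω]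
  {P : Measure Ω} (pop : Population T 𝒳 Ω)

theorem measurableSet_cohortEvent (g : Cohort T) : MeasurableSet (pop.cohortEvent g) :=
  pop.measurable_cohort (measurableSet_singleton g)

/-- The treatment path is random, but takes only countably many values through the cohort. -/
theorem measurable_Yobs (t : Fin T) : Measurable (pop.Yobs t) :=
  (measurable_from_prod_countable_right (f := fun q : Cohort T × Ω => pop.Y t (cohortPath q.1) q.2)
    fun g => pop.measurable_Y t (cohortPath g)).comp (pop.measurable_cohort.prodMk measurable_id)

theorem measurable_obs : Measurable pop.obs :=
  (measurable_pi_lambda _ pop.measurable_Yobs).prodMk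
    (pop.measurable_cohort.prodMk pop.measurable_X)

theorem measureReal_covariate_mul_e [IsProbabilityMeasure P] (g : Cohort T) (x : 𝒳) :
    P.real {ω | pop.X ω = x} * pop.e P g x = P.real (pop.cell g x) := by
  have h : P.real (pop.cell g x) = ∫ ω in {ω | pop.X ω = x},
      (pop.cohortEvent g).indicator 1 ω ∂P := by
    rw [integral_indicator_one (pop.measurableSet_cohortEvent g),
      measureReal_restrict_apply (pop.measurableSet_cohortEvent g)]
    rfl
  rw [h, setIntegral_eq_measureReal_mul_cond,
    integral_indicator_one (pop.measurableSet_cohortEvent g)]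
  rfl

/-- Common support: a covariate value without never-treated units has probability zero. -/
theorem Overlap.measure_covariate_eq_zero [IsProbabilityMeasure P] {pop : Population T 𝒳 Ω}
    (h : pop.Overlap P) {x : 𝒳} (hx : P (pop.cell ⊤ x) = 0) : P {ω | pop.X ω = x} = 0 := by
  by_contra h0
  have hpos := h.2.2
  -- An event of positive probability meets the almost sure event `e_∞(X) > 0`.
  obtain ⟨ω, hω, he⟩ := (Frequently.and_eventually (frequently_ae_iff.2 h0) hpos).exists
  have hω' : pop.X ω = x := hω
  rw [hω'] at he
  have h1 := pop.measureReal_covariate_mul_e (P := P) ⊤ x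
  rw [measureReal_def P (pop.cell ⊤ x), hx] at h1
  have : 0 < P.real {ω | pop.X ω = x} := ENNReal.toReal_pos h0 (measure_ne_top _ _)
  have := mul_pos this he
  simp [h1] at this

section

variable [MeasurableSingletonClass 𝒳]

theorem measurableSet_covariate (x : 𝒳) : MeasurableSet {ω | pop.X ω = x} :=
  pop.measurable_X (measurableSet_singleton x)

theorem measurableSet_cell (g : Cohort T) (x : 𝒳) : MeasurableSet (pop.cell g x) :=
  (pop.measurableSet_cohortEvent g).inter (pop.measurableSet_covariate x)

end

/-! ### Square integrability. -/

section Moments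

variable [Finite 𝒳] [IsProbabilityMeasure P]

/-- Finitely many cells cover the space and null cells do not matter, so the conditional bounds give
a finite fourth moment; then y² ≤ y⁴ + 1. -/
theorem BoundedFourthMoments.memLp_two {pop : Population T 𝒳 Ω} (h : pop.BoundedFourthMoments P)
    (t : Fin T) (d : Path T) : MemLp (pop.Y t d) 2 P := by
  obtain ⟨C, hC⟩ := h
  have hm := pop.measurable_Y t d
  have hcell (q : Cohort T × 𝒳) :
      IntegrableOn (fun ω => pop.Y t d ω ^ 4) (pop.cell q.1 q.2) P := by
    by_cases h0 : P (pop.cell q.1 q.2) = 0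
    · rw [IntegrableOn, Measure.restrict_eq_zero.2 h0]
      exact integrable_zero_measure
    · have hi : Integrable (fun ω => pop.Y t d ω ^ 4) P[|pop.cell q.1 q.2] := by
        refine ⟨(hm.pow_const 4).aestronglyMeasurable, ?_⟩
        rw [hasFiniteIntegral_iff_ofReal (Eventually.of_forall fun ω => by positivity)]
        exact (hC t d q.1 q.2 h0).trans_lt ENNReal.coe_lt_top
      have := hi.smul_measure (measure_ne_top P (pop.cell q.1 q.2))
      rwa [ProbabilityTheory.cond, smul_smul, ENNReal.mul_inv_cancel h0 (measure_ne_top _ _),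
        one_smul] at this
  have h4 : Integrable (fun ω => pop.Y t d ω ^ 4) P := by
    rw [← integrableOn_univ]
    have hu : (Set.univ : Set Ω) = ⋃ q : Cohort T × 𝒳, pop.cell q.1 q.2 := by
      ext ω
      simp [cell]
    rw [hu, integrableOn_finite_iUnion]
    exact hcell
  refine (memLp_two_iff_integrable_sq hm.aestronglyMeasurable).2 ?_
  refine (h4.add (integrable_const 1)).mono' (hm.pow_const 2).aestronglyMeasurable
    (Eventually.of_forall fun ω => ?_)
  rw [Real.norm_eq_abs, abs_of_nonneg (sq_nonneg _), Pi.add_apply]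
  nlinarith [sq_nonneg (pop.Y t d ω ^ 2 - 1), sq_nonneg (pop.Y t d ω ^ 2)]

variable {pop}

theorem BoundedFourthMoments.memLp_Yobs (h : pop.BoundedFourthMoments P) (t : Fin T) :
    MemLp (pop.Yobs t) 2 P := by
  have : pop.Yobs t = fun ω => ∑ g : Cohort T,
      (pop.cohortEvent g).indicator (pop.Y t (cohortPath g)) ω := by
    ext ω
    rw [Finset.sum_eq_single (pop.cohort ω)]
    · rw [Set.indicator_of_mem (by simp [cohortEvent])]
      rfl
    · intro g _ hg
      refine Set.indicator_of_notMem ?_ _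
      exact fun hω : pop.cohort ω = g => hg hω.symm
    · simp
  rw [this]
  exact memLp_finsetSum _ fun g _ => (h.memLp_two t _).indicator (pop.measurableSet_cohortEvent g)

theorem BoundedFourthMoments.memLp_DeltaY (h : pop.BoundedFourthMoments P) (lam : Fin T → ℝ)
    (s : Fin T) : MemLp (pop.DeltaY lam s) 2 P := by
  have : pop.DeltaY lam s = fun ω => ∑ t,
      (postWeight lam s t - preWeight lam s t) * pop.Yobs t ω :=
    funext fun ω => deltaY_eq_sum lam s _
  rw [this]
  exact memLp_finsetSum _ fun t _ => (h.memLp_Yobs t).const_mul _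

theorem BoundedFourthMoments.memLp_tauPost (h : pop.BoundedFourthMoments P) (lam : Fin T → ℝ)
    (s : Fin T) : MemLp (pop.tauPost lam s) 2 P := by
  have : pop.tauPost lam s = fun ω => ∑ t,
      postWeight lam s t * (pop.Yobs t ω - pop.Y0 t ω) :=
    funext fun ω => postAvg_eq_sum lam s _
  rw [this]
  exact memLp_finsetSum _ fun t _ => ((h.memLp_Yobs t).sub (h.memLp_two t _)).const_mul _

end Moments

-- Before `s` the path of cohort `s` agrees with the zero path, so the pre-average is untreated; the
-- post-average splits off τ by definition.
variable {pop} in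
theorem NoAnticipation.ae_DeltaY_eq (h : pop.NoAnticipation P) (lam : Fin T → ℝ) (s : Fin T) :
    ∀ᵐ ω ∂P, pop.cohort ω = s →
      pop.DeltaY lam s ω = pop.tauPost lam s ω + deltaY lam s (fun t => pop.Y0 t ω) := by
  have h' : ∀ t, t < s → pop.Y t (cohortPath s) =ᵐ[P] pop.Y t (cohortPath ⊤) := by
    intro t ht
    refine h t _ _ fun r hr => ?_
    have : ¬ s ≤ r := not_le.2 (hr.trans_lt ht)
    simp [cohortPath, this]
  have h'' : ∀ᵐ ω ∂P, ∀ t, t < s → pop.Y t (cohortPath s) ω = pop.Y t (cohortPath ⊤) ω := by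
    rw [ae_all_iff]
    intro t
    by_cases ht : t < s
    · filter_upwards [h' t ht] with ω hω _ using hω
    · simp [ht]
  filter_upwards [h''] with ω hω hs
  have hpre : preAvg lam s (fun t => pop.Yobs t ω) = preAvg lam s (fun t => pop.Y0 t ω) := by
    rw [preAvg, preAvg]
    congr 1
    refine Finset.sum_congr rfl fun t ht => ?_
    rw [Yobs, Y0, hs, hω t (by simpa using ht)]
  have hpost : postAvg lam s (fun t => pop.Yobs t ω)
      = pop.tauPost lam s ω + postAvg lam s (fun t => pop.Y0 t ω) := by
    simp only [tauPost, postAvg_eq_sum, ← Finset.sum_add_distrib]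
    refine Finset.sum_congr rfl fun t _ => ?_
    simp only [tau, Yobs]
    ring
  rw [DeltaY, deltaY, deltaY, hpre, hpost]
  ring

/-! ### Identification of the conditional ATT. -/

section Identification

variable [MeasurableSingletonClass 𝒳] [IsProbabilityMeasure P] {pop}

/-- Under parallel trends the mean untreated trend within a cell depends on its covariate value
only. -/
theorem ParallelTrends.integral_cell_eq (h : pop.ParallelTrends P) {t' t : Fin T}
    (ht : t'.val + 1 = t.val) (hint : ∀ t, Integrable (pop.Y0 t) P) {g g' : Cohort T} {x : 𝒳}
    (hg : P (pop.cell g x) ≠ 0) (hg' : P (pop.cell g' x) ≠ 0) :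
    ∫ ω, (pop.Y0 t ω - pop.Y0 t' ω) ∂P[|pop.cell g x]
      = ∫ ω, (pop.Y0 t ω - pop.Y0 t' ω) ∂P[|pop.cell g' x] := by
  have hf : Integrable (fun ω => pop.Y0 t ω - pop.Y0 t' ω) P := (hint t).sub (hint t')
  have hm : MeasurableSpace.comap (fun ω => (pop.cohort ω, pop.X ω)) inferInstance
      ≤ (inferInstance : MeasurableSpace Ω) :=
    (pop.measurable_cohort.prodMk pop.measurable_X).comap_le
  -- A conditional expectation given X is a function of X, hence constant on {X = x}; the point `ω₀`
  -- serves to name that constant.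
  have hfac := (stronglyMeasurable_condExp (μ := P) (m := MeasurableSpace.comap pop.X inferInstance)
    (f := fun ω => pop.Y0 t ω - pop.Y0 t' ω)).factorsThrough
  obtain ⟨ω₀, hω₀⟩ := nonempty_of_measure_ne_zero hg
  have key (k : Cohort T) (hk : P (pop.cell k x) ≠ 0) :
      ∫ ω, (pop.Y0 t ω - pop.Y0 t' ω) ∂P[|pop.cell k x]
        = P[fun ω => pop.Y0 t ω - pop.Y0 t' ω | MeasurableSpace.comap pop.X inferInstance] ω₀ := by
    have hk' : P.real (pop.cell k x) ≠ 0 := (measureReal_ne_zero_iff).2 hk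
    apply mul_left_cancel₀ hk'
    rw [← setIntegral_eq_measureReal_mul_cond, ← setIntegral_condExp hm hf,
      setIntegral_congr_ae (pop.measurableSet_cell k x) ((h t' t ht).mono fun ω hω _ => hω),
      setIntegral_congr_fun (pop.measurableSet_cell k x)
        (fun ω hω => hfac (show pop.X ω = pop.X ω₀ from hω.2.trans hω₀.2.symm))]
    · simp
    · refine ⟨{(k, x)}, measurableSet_singleton _, ?_⟩
      ext ω
      simp [cell]
  rw [key g hg, key g' hg']

/-- Identification: within a covariate cell, the mean of `ΔȲ` in cohort `s` exceeds that of the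
never-treated by the conditional average treatment effect. -/
theorem integral_DeltaY_cell [Finite 𝒳] (hanticip : pop.NoAnticipation P)
    (htrends : pop.ParallelTrends P) (hmoments : pop.BoundedFourthMoments P) {s : Fin T}
    {lam : Fin T → ℝ} (hlam : ∀ t, lam t = 0 ∨ lam t = 1)
    (hpost : ∃ t, s ≤ t ∧ lam t = 1) (hpre : ∃ t, t < s ∧ lam t = 1) {x : 𝒳}
    (hs : P (pop.cell s x) ≠ 0) (htop : P (pop.cell ⊤ x) ≠ 0) :
    ∫ ω, pop.DeltaY lam s ω ∂P[|pop.cell s x]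
      = ∫ ω, pop.DeltaY lam s ω ∂P[|pop.cell ⊤ x] + pop.catt P lam s x := by
  have hY0 (t : Fin T) : MemLp (pop.Y0 t) 2 P := hmoments.memLp_two t _
  have hY0c (t : Fin T) {A : Set Ω} (hA : P A ≠ 0) : Integrable (pop.Y0 t) P[|A] := by
    have := cond_isProbabilityMeasure hA
    exact (memLp_cond (hY0 t) hA).integrable one_le_two
  have hdelta {A : Set Ω} (hA : P A ≠ 0) :
      ∫ ω, deltaY lam s (fun t => pop.Y0 t ω) ∂P[|A]
        = ∑ t, (postWeight lam s t - preWeight lam s t) * ∫ ω, pop.Y0 t ω ∂P[|A] := by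
    simp_rw [deltaY_eq_sum]
    rw [integral_finsetSum _ fun t _ => (hY0c t hA).const_mul _]
    simp_rw [integral_const_mul]
  have hint : Integrable (fun ω => deltaY lam s (fun t => pop.Y0 t ω)) P[|pop.cell s x] := by
    simp_rw [deltaY_eq_sum]
    exact integrable_finsetSum _ fun t _ => (hY0c t hs).const_mul _
  have hconst := eq_of_succ_eq (f := fun t => ∫ ω, pop.Y0 t ω ∂P[|pop.cell s x]
      - ∫ ω, pop.Y0 t ω ∂P[|pop.cell ⊤ x]) (by
    intro t' t ht
    have := htrends.integral_cell_eq ht (fun t => (hY0 t).integrable one_le_two) hs htop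
    rw [integral_sub (hY0c t hs) (hY0c t' hs), integral_sub (hY0c t htop) (hY0c t' htop)] at this
    linarith)
  have htopEq : ∫ ω, pop.DeltaY lam s ω ∂P[|pop.cell ⊤ x]
      = ∫ ω, deltaY lam s (fun t => pop.Y0 t ω) ∂P[|pop.cell ⊤ x] := by
    refine integral_congr_ae ?_
    filter_upwards [ae_cond_mem (pop.measurableSet_cell ⊤ x)] with ω hω
    simp only [DeltaY, Yobs, Y0, hω.1]
  have hsEq : ∫ ω, pop.DeltaY lam s ω ∂P[|pop.cell s x]
      = pop.catt P lam s x + ∫ ω, deltaY lam s (fun t => pop.Y0 t ω) ∂P[|pop.cell s x] := by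
    have := cond_isProbabilityMeasure hs
    rw [catt, ← integral_add ((memLp_cond (hmoments.memLp_tauPost lam s) hs).integrable one_le_two)
      hint]
    refine integral_congr_ae ?_
    filter_upwards [ae_cond_mem (pop.measurableSet_cell s x),
      ae_cond_of_ae (hanticip.ae_DeltaY_eq lam s) _] with ω hω hω'
    exact hω' hω.1
  have hsub : ∫ ω, deltaY lam s (fun t => pop.Y0 t ω) ∂P[|pop.cell s x]
      = ∫ ω, deltaY lam s (fun t => pop.Y0 t ω) ∂P[|pop.cell ⊤ x] := by
    -- By `hconst` the gap between the two cohorts factors out of the sum, and the weights sum to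
    -- zero.
    rw [hdelta hs, hdelta htop, ← sub_eq_zero, ← Finset.sum_sub_distrib]
    simp_rw [← mul_sub]
    rw [Finset.sum_congr rfl fun t _ => by rw [hconst t s], ← Finset.sum_mul,
      sum_deltaWeight hlam hpost hpre, zero_mul]
  rw [hsEq, hsub, htopEq, add_comm]

end Identification

/-! ### Population quantities as sums over cells. -/

section CellSums

variable [Fintype 𝒳] [MeasurableSingletonClass 𝒳]

/-- The integrand may depend on the covariate value too, as the centring at `m (X)` requires. -/
theorem integral_cohort_mul (g : Cohort T) {F : 𝒳 → Ω → ℝ} (hF : ∀ x, Integrable (F x) P) :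
    ∫ ω, (if pop.cohort ω = g then 1 else 0) * F (pop.X ω) ω ∂P
      = ∑ x, ∫ ω in pop.cell g x, F x ω ∂P := by
  have h (ω : Ω) : (if pop.cohort ω = g then 1 else 0) * F (pop.X ω) ω
      = ∑ x, (pop.cell g x).indicator (F x) ω := by
    rw [Finset.sum_eq_single (pop.X ω)]
    · by_cases hg : pop.cohort ω = g <;> simp [cell, hg]
    · intro x _ hx
      refine Set.indicator_of_notMem ?_ _
      exact fun hω : ω ∈ pop.cell g x => hx hω.2.symm
    · simp
  simp_rw [h]
  rw [integral_finsetSum _ fun x _ => (hF x).indicator (pop.measurableSet_cell g x)]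
  simp_rw [integral_indicator (pop.measurableSet_cell g _)]

theorem integral_comp_covariate [IsProbabilityMeasure P] (F : 𝒳 → ℝ) :
    ∫ ω, F (pop.X ω) ∂P = ∑ x, P.real {ω | pop.X ω = x} * F x := by
  have h (ω : Ω) : F (pop.X ω) = ∑ x, {ω | pop.X ω = x}.indicator (fun _ => F x) ω := by
    classical simp [Set.indicator_apply]
  simp_rw [h]
  rw [integral_finsetSum _ fun x _ =>
    (integrable_const _).indicator (pop.measurableSet_covariate x)]
  simp_rw [integral_indicator_const _ (pop.measurableSet_covariate _), smul_eq_mul]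

theorem p_mul_att [IsProbabilityMeasure P] {pop : Population T 𝒳 Ω}
    (hmoments : pop.BoundedFourthMoments P) (lam : Fin T → ℝ) (s : Fin T) :
    pop.p P s * pop.att P lam s = ∑ x, P.real (pop.cell s x) * pop.catt P lam s x := by
  have h := pop.integral_cohort_mul (P := P) s (F := fun _ => pop.tauPost lam s)
    fun _ => (hmoments.memLp_tauPost lam s).integrable one_le_two
  simp_rw [setIntegral_eq_measureReal_mul_cond] at h
  rw [p, att, ← setIntegral_eq_measureReal_mul_cond,
    ← integral_indicator (pop.measurableSet_cohortEvent s)]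
  refine Eq.trans (integral_congr_ae (Eventually.of_forall fun ω => ?_)) h
  by_cases hg : pop.cohort ω = s <;> simp [cohortEvent, hg]

theorem p_eq_sum [IsProbabilityMeasure P] (g : Cohort T) :
    pop.p P g = ∑ x, P.real (pop.cell g x) := by
  have h := pop.integral_cohort_mul (P := P) g (F := fun _ _ => 1) fun _ => integrable_const _
  simp only [integral_const, measureReal_restrict_apply MeasurableSet.univ, Set.univ_inter,
    smul_eq_mul, mul_one] at h
  rw [← h, p, ← integral_indicator_one (pop.measurableSet_cohortEvent g)]
  refine integral_congr_ae (Eventually.of_forall fun ω => ?_)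
  simp [cohortEvent, Set.indicator_apply]

/-- The efficiency bound as a sum over covariate values. -/
theorem VSEB_eq_sum [IsProbabilityMeasure P] (lam : Fin T → ℝ) (s : Fin T) :
    pop.VSEB P lam s = (1 / pop.p P s) ^ 2 *
      (∑ x, P.real (pop.cell s x) *
          (pop.sigmaSq P lam s s x + (pop.catt P lam s x - pop.att P lam s) ^ 2)
        + ∑ x, P.real (pop.cell ⊤ x) *
          ((P.real (pop.cell s x) / P.real (pop.cell ⊤ x)) ^ 2 * pop.sigmaSq P lam s ⊤ x)) := by
  rw [VSEB, pop.integral_comp_covariate (fun x => pop.sigmaSq P lam s s x * pop.e P s x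
      / pop.p P s ^ 2 + (pop.catt P lam s x - pop.att P lam s) ^ 2 * pop.e P s x / pop.p P s ^ 2),
    pop.integral_comp_covariate (fun x => pop.e P s x ^ 2 * pop.sigmaSq P lam s ⊤ x
      / (pop.p P s ^ 2 * pop.e P ⊤ x)), mul_add, Finset.mul_sum, Finset.mul_sum]
  congr 1 <;> refine Finset.sum_congr rfl fun x _ => ?_
  · rw [← pop.measureReal_covariate_mul_e]
    ring
  · simp_rw [← pop.measureReal_covariate_mul_e (P := P)]
    -- In each degenerate case both sides are 0 under `a / 0 = 0`.
    by_cases hq : P.real {ω | pop.X ω = x} = 0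
    · simp [hq]
    by_cases he : pop.e P ⊤ x = 0
    · simp [he]
    by_cases hp : pop.p P s = 0
    · simp [hp]
    field_simp

theorem VSEB_nonneg [IsProbabilityMeasure P] (lam : Fin T → ℝ) (s : Fin T) :
    0 ≤ pop.VSEB P lam s := by
  rw [VSEB_eq_sum]
  have h (g : Cohort T) (x : 𝒳) : 0 ≤ pop.sigmaSq P lam s g x := variance_nonneg _ _
  exact mul_nonneg (sq_nonneg _) (add_nonneg
    (Finset.sum_nonneg fun x _ => mul_nonneg measureReal_nonneg (add_nonneg (h _ _) (sq_nonneg _)))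
    (Finset.sum_nonneg fun x _ => mul_nonneg measureReal_nonneg
      (mul_nonneg (sq_nonneg _) (h _ _))))

end CellSums

end Population

/-! ### Scores and influence function. -/

section Scores

variable {T : ℕ} {𝒳 : Type*} [DecidableEq 𝒳]

/-- The centred contribution of a unit of cohort `s`. -/
noncomputable def treatedScore (lam : Fin T → ℝ) (s : Fin T) (m : 𝒳 → ℝ) (θ : ℝ)
    (o : Obs T 𝒳) : ℝ :=
  (if o.2.1 = (s : Cohort T) then 1 else 0) * (deltaY lam s o.1 - m o.2.2 - θ)

/-- The centred contribution of a never-treated unit with covariate value `x`. -/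
noncomputable def controlScore (lam : Fin T → ℝ) (s : Fin T) (m : 𝒳 → ℝ) (x : 𝒳)
    (o : Obs T 𝒳) : ℝ :=
  (if o.2.1 = ⊤ then 1 else 0) * (if o.2.2 = x then 1 else 0) * (deltaY lam s o.1 - m x)

/-- The influence function of `τ̂_disc`. -/
noncomputable def influence [Fintype 𝒳] (lam : Fin T → ℝ) (s : Fin T) (m r : 𝒳 → ℝ) (θ p : ℝ)
    (o : Obs T 𝒳) : ℝ :=
  1 / p * (treatedScore lam s m θ o - ∑ x, r x * controlScore lam s m x o)

theorem sum_mul_controlScore [Fintype 𝒳] (lam : Fin T → ℝ) (s : Fin T) (m r : 𝒳 → ℝ)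
    (o : Obs T 𝒳) : ∑ x, r x * controlScore lam s m x o
      = (if o.2.1 = ⊤ then 1 else 0) * (r o.2.2 * (deltaY lam s o.1 - m o.2.2)) := by
  rw [Finset.sum_eq_single o.2.2]
  · simp [controlScore]
  · intro x _ hx
    simp [controlScore, hx.symm]
  · simp

variable [MeasurableSpace 𝒳] [MeasurableSingletonClass 𝒳]

omit [DecidableEq 𝒳] [MeasurableSingletonClass 𝒳] in
theorem measurable_ite_cohort (g : Cohort T) :
    Measurable fun o : Obs T 𝒳 => if o.2.1 = g then (1 : ℝ) else 0 :=
  Measurable.ite ((measurable_fst.comp measurable_snd) (measurableSet_singleton g))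
    measurable_const measurable_const

theorem measurable_ite_covariate (x : 𝒳) :
    Measurable fun o : Obs T 𝒳 => if o.2.2 = x then (1 : ℝ) else 0 :=
  Measurable.ite ((measurable_snd.comp measurable_snd) (measurableSet_singleton x))
    measurable_const measurable_const

omit [DecidableEq 𝒳] in
theorem measurable_treatedScore [Finite 𝒳] (lam : Fin T → ℝ) (s : Fin T) (m : 𝒳 → ℝ) (θ : ℝ) :
    Measurable (treatedScore lam s m θ) :=
  (measurable_ite_cohort _).mul ((((measurable_deltaY lam s).comp measurable_fst).sub
    ((measurable_of_countable m).comp (measurable_snd.comp measurable_snd))).sub measurable_const)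

theorem measurable_controlScore (lam : Fin T → ℝ) (s : Fin T) (m : 𝒳 → ℝ) (x : 𝒳) :
    Measurable (controlScore lam s m x) :=
  ((measurable_ite_cohort _).mul (measurable_ite_covariate x)).mul
    (((measurable_deltaY lam s).comp measurable_fst).sub measurable_const)

theorem measurable_influence [Fintype 𝒳] (lam : Fin T → ℝ) (s : Fin T) (m r : 𝒳 → ℝ) (θ p : ℝ) :
    Measurable (influence lam s m r θ p) :=
  ((measurable_treatedScore lam s m θ).sub (Finset.measurable_fun_sum _ fun x _ =>
    (measurable_controlScore lam s m x).const_mul (r x))).const_mul _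

section AEMeasurability

variable {Ω' : Type*} [MeasurableSpace Ω'] {P' : Measure Ω'} {W : ℕ → Ω' → Obs T 𝒳}

omit [DecidableEq 𝒳] [MeasurableSingletonClass 𝒳] in
theorem aemeasurable_cohortCount (hW : ∀ i, AEMeasurable (W i) P') (n : ℕ) (g : Cohort T) :
    AEMeasurable (fun ω => cohortCount (fun k => W k ω) n g) P' :=
  Finset.aemeasurable_fun_sum _ fun i _ => (measurable_ite_cohort g).comp_aemeasurable (hW i)

theorem aemeasurable_cellCount (hW : ∀ i, AEMeasurable (W i) P') (n : ℕ) (g : Cohort T) (x : 𝒳) :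
    AEMeasurable (fun ω => cellCount (fun k => W k ω) n g x) P' :=
  Finset.aemeasurable_fun_sum _ fun i _ =>
    ((measurable_ite_cohort g).mul (measurable_ite_covariate x)).comp_aemeasurable (hW i)

/-- The count ratios are evaluated at random covariates; regrouping by x leaves ratios at fixed
values. -/
theorem aemeasurable_tauDisc [Finite 𝒳] (hW : ∀ i, AEMeasurable (W i) P') (n : ℕ)
    (lam : Fin T → ℝ) (s : Fin T) :
    AEMeasurable (fun ω => tauDisc (fun k => W k ω) n lam s) P' := by
  cases nonempty_fintype 𝒳
  have hD : Measurable fun o : Obs T 𝒳 => deltaY lam s o.1 :=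
    (measurable_deltaY lam s).comp measurable_fst
  have h (ω : Ω') := sum_mul_comp_covariate (fun k => W k ω) n
    (fun i => (if (W i ω).2.1 = ⊤ then 1 else 0) * deltaY lam s (W i ω).1)
    (fun x => cellCount (fun k => W k ω) n s x / cellCount (fun k => W k ω) n ⊤ x)
  simp_rw [tauDisc_eq, h]
  refine ((aemeasurable_cohortCount hW n s).const_div 1).mul (AEMeasurable.sub ?_ ?_)
  · exact Finset.aemeasurable_fun_sum _ fun i _ =>
      ((measurable_ite_cohort _).mul hD).comp_aemeasurable (hW i)
  · refine Finset.aemeasurable_fun_sum _ fun x _ =>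
      ((aemeasurable_cellCount hW n s x).div (aemeasurable_cellCount hW n ⊤ x)).mul ?_
    exact Finset.aemeasurable_fun_sum _ fun i _ =>
      (((measurable_ite_cohort _).mul hD).mul
        (measurable_ite_covariate x)).comp_aemeasurable (hW i)

end AEMeasurability

end Scores

/-! ### Moments of the scores. -/

namespace Population

variable {T : ℕ} {𝒳 Ω : Type*} [Fintype 𝒳] [DecidableEq 𝒳] [MeasurableSpace 𝒳]
  [MeasurableSingletonClass 𝒳] [MeasurableSpace Ω] {P : Measure Ω} [IsProbabilityMeasure P]
  {pop : Population T 𝒳 Ω}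

section ScoreMoments

variable (hmoments : pop.BoundedFourthMoments P) {lam : Fin T → ℝ} {s : Fin T}
include hmoments

omit [DecidableEq 𝒳] [MeasurableSingletonClass 𝒳] in
theorem BoundedFourthMoments.memLp_DeltaY_sub (c : ℝ) :
    MemLp (fun ω => pop.DeltaY lam s ω - c) 2 P :=
  (hmoments.memLp_DeltaY lam s).sub (memLp_const c)

theorem BoundedFourthMoments.memLp_controlScore (m : 𝒳 → ℝ) (x : 𝒳) :
    MemLp (fun ω => controlScore lam s m x (pop.obs ω)) 2 P := by
  have : (fun ω => controlScore lam s m x (pop.obs ω))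
      = (pop.cell ⊤ x).indicator (fun ω => pop.DeltaY lam s ω - m x) := by
    ext ω
    by_cases h1 : pop.cohort ω = ⊤ <;> by_cases h2 : pop.X ω = x <;>
      simp [controlScore, obs, cell, h1, h2, DeltaY]
  rw [this]
  exact (hmoments.memLp_DeltaY_sub _).indicator (pop.measurableSet_cell ⊤ x)

omit [DecidableEq 𝒳] in
theorem BoundedFourthMoments.memLp_treatedScore (m : 𝒳 → ℝ) (θ : ℝ) :
    MemLp (fun ω => treatedScore lam s m θ (pop.obs ω)) 2 P := by
  have : (fun ω => treatedScore lam s m θ (pop.obs ω)) = fun ω => ∑ x,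
      (pop.cell s x).indicator (fun ω => pop.DeltaY lam s ω - (m x + θ)) ω := by
    ext ω
    rw [Finset.sum_eq_single (pop.X ω)]
    · by_cases h1 : pop.cohort ω = s <;> simp [treatedScore, obs, cell, h1, DeltaY, sub_sub]
    · intro x _ hx
      refine Set.indicator_of_notMem ?_ _
      exact fun hω : ω ∈ pop.cell s x => hx hω.2.symm
    · simp
  rw [this]
  exact memLp_finsetSum _ fun x _ =>
    (hmoments.memLp_DeltaY_sub _).indicator (pop.measurableSet_cell s x)

theorem BoundedFourthMoments.memLp_influence (m r : 𝒳 → ℝ) (θ p : ℝ) :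
    MemLp (fun ω => influence lam s m r θ p (pop.obs ω)) 2 P :=
  ((hmoments.memLp_treatedScore m θ).sub (memLp_finsetSum _ fun x _ =>
    (hmoments.memLp_controlScore m x).const_mul (r x))).const_mul _

omit [DecidableEq 𝒳] [MeasurableSingletonClass 𝒳] in
theorem BoundedFourthMoments.setIntegral_DeltaY_sub (A : Set Ω) (c : ℝ) :
    ∫ ω in A, (pop.DeltaY lam s ω - c) ∂P
      = P.real A * (∫ ω, pop.DeltaY lam s ω ∂P[|A] - c) := by
  rw [setIntegral_eq_measureReal_mul_cond]
  by_cases hA : P A = 0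
  · simp [measureReal_def, hA]
  have := cond_isProbabilityMeasure hA
  rw [integral_sub ((memLp_cond (hmoments.memLp_DeltaY lam s) hA).integrable one_le_two)
    (integrable_const _)]
  simp

omit [DecidableEq 𝒳] [MeasurableSingletonClass 𝒳] in
theorem BoundedFourthMoments.setIntegral_DeltaY_sub_sq (A : Set Ω) (c : ℝ) :
    ∫ ω in A, (pop.DeltaY lam s ω - c) ^ 2 ∂P
      = P.real A * (variance (pop.DeltaY lam s) P[|A]
        + (∫ ω, pop.DeltaY lam s ω ∂P[|A] - c) ^ 2) := by
  rw [setIntegral_eq_measureReal_mul_cond]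
  by_cases hA : P A = 0
  · simp [measureReal_def, hA]
  have := cond_isProbabilityMeasure hA
  rw [integral_sub_const_sq (memLp_cond (hmoments.memLp_DeltaY lam s) hA)]

theorem integral_controlScore {m : 𝒳 → ℝ}
    (hm : ∀ x, m x = ∫ ω, pop.DeltaY lam s ω ∂P[|pop.cell ⊤ x]) (x : 𝒳) :
    ∫ ω, controlScore lam s m x (pop.obs ω) ∂P = 0 := by
  have : (fun ω => controlScore lam s m x (pop.obs ω))
      = (pop.cell ⊤ x).indicator (fun ω => pop.DeltaY lam s ω - m x) := by
    ext ω
    by_cases h1 : pop.cohort ω = ⊤ <;> by_cases h2 : pop.X ω = x <;>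
      simp [controlScore, obs, cell, h1, h2, DeltaY]
  rw [this, integral_indicator (pop.measurableSet_cell ⊤ x), hmoments.setIntegral_DeltaY_sub,
    ← hm, sub_self, mul_zero]

-- Given identification, cell x contributes its probability times `catt - att`, and these sum to
-- zero by `p_mul_att`.
omit [DecidableEq 𝒳] in
theorem integral_treatedScore {m : 𝒳 → ℝ}
    (hm : ∀ x, P (pop.cell s x) ≠ 0 →
      ∫ ω, pop.DeltaY lam s ω ∂P[|pop.cell s x] = m x + pop.catt P lam s x) :
    ∫ ω, treatedScore lam s m (pop.att P lam s) (pop.obs ω) ∂P = 0 := by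
  have h := pop.integral_cohort_mul (P := P) s
    (F := fun x ω => pop.DeltaY lam s ω - (m x + pop.att P lam s))
    fun x => (hmoments.memLp_DeltaY_sub _).integrable one_le_two
  have h' (x : 𝒳) : ∫ ω in pop.cell s x, (pop.DeltaY lam s ω - (m x + pop.att P lam s)) ∂P
      = P.real (pop.cell s x) * pop.catt P lam s x
        - P.real (pop.cell s x) * pop.att P lam s := by
    rw [hmoments.setIntegral_DeltaY_sub]
    by_cases h0 : P (pop.cell s x) = 0
    · simp [measureReal_def, h0]
    · rw [hm x h0]
      ring
  simp_rw [h', Finset.sum_sub_distrib, ← Finset.sum_mul, ← pop.p_eq_sum,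
    ← p_mul_att hmoments, sub_self] at h
  rw [← h]
  refine integral_congr_ae (Eventually.of_forall fun ω => ?_)
  by_cases hω : pop.cohort ω = s <;> simp [treatedScore, obs, DeltaY, sub_sub, hω]

/-- Each treated cell contributes its variance plus the squared deviation of its effect from the
ATT; never-treated cells are centred at their own mean and contribute variance only. -/
theorem integral_influence_sq {m : 𝒳 → ℝ}
    (hm : ∀ x, m x = ∫ ω, pop.DeltaY lam s ω ∂P[|pop.cell ⊤ x])
    (hms : ∀ x, P (pop.cell s x) ≠ 0 →
      ∫ ω, pop.DeltaY lam s ω ∂P[|pop.cell s x] = m x + pop.catt P lam s x) :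
    ∫ ω, influence lam s m (fun x => P.real (pop.cell s x) / P.real (pop.cell ⊤ x))
      (pop.att P lam s) (pop.p P s) (pop.obs ω) ^ 2 ∂P = pop.VSEB P lam s := by
  have hS := pop.integral_cohort_mul (P := P) s
    (F := fun x ω => (pop.DeltaY lam s ω - (m x + pop.att P lam s)) ^ 2)
    fun x => (hmoments.memLp_DeltaY_sub _).integrable_sq
  have hC := pop.integral_cohort_mul (P := P) ⊤
    (F := fun x ω => (P.real (pop.cell s x) / P.real (pop.cell ⊤ x)) ^ 2
      * (pop.DeltaY lam s ω - m x) ^ 2)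
    fun x => ((hmoments.memLp_DeltaY_sub _).integrable_sq).const_mul _
  have hSi : Integrable (fun ω => treatedScore lam s m (pop.att P lam s) (pop.obs ω) ^ 2) P :=
    (hmoments.memLp_treatedScore m _).integrable_sq
  have hCi : Integrable (fun ω => (∑ x, P.real (pop.cell s x) / P.real (pop.cell ⊤ x)
      * controlScore lam s m x (pop.obs ω)) ^ 2) P :=
    (memLp_finsetSum _ fun x _ => (hmoments.memLp_controlScore m x).const_mul _).integrable_sq
  have hsq (ω : Ω) : influence lam s m (fun x => P.real (pop.cell s x) / P.real (pop.cell ⊤ x))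
      (pop.att P lam s) (pop.p P s) (pop.obs ω) ^ 2
      = (1 / pop.p P s) ^ 2 * (treatedScore lam s m (pop.att P lam s) (pop.obs ω) ^ 2
        + (∑ x, P.real (pop.cell s x) / P.real (pop.cell ⊤ x)
          * controlScore lam s m x (pop.obs ω)) ^ 2) := by
    -- No cross term: a unit is never both in cohort `s` and never treated.
    have : treatedScore lam s m (pop.att P lam s) (pop.obs ω)
        * (∑ x, P.real (pop.cell s x) / P.real (pop.cell ⊤ x)
          * controlScore lam s m x (pop.obs ω)) = 0 := by
      rw [sum_mul_controlScore lam s m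
        (fun x => P.real (pop.cell s x) / P.real (pop.cell ⊤ x))]
      by_cases h : pop.cohort ω = ⊤ <;> simp [treatedScore, obs, h]
    rw [influence, mul_pow, sub_sq, mul_assoc 2, this]
    ring
  simp_rw [hsq]
  rw [integral_const_mul, integral_add hSi hCi, VSEB_eq_sum]
  congr 2
  · refine Eq.trans (integral_congr_ae (Eventually.of_forall fun ω => ?_))
      (hS.trans (Finset.sum_congr rfl fun x _ => ?_))
    · by_cases h : pop.cohort ω = s <;> simp [treatedScore, obs, DeltaY, sub_sub, h]
    · rw [hmoments.setIntegral_DeltaY_sub_sq]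
      by_cases h0 : P (pop.cell s x) = 0
      · simp [measureReal_def, h0]
      · rw [hms x h0, sigmaSq]
        ring
  · refine Eq.trans (integral_congr_ae (Eventually.of_forall fun ω => ?_))
      (hC.trans (Finset.sum_congr rfl fun x _ => ?_))
    · simp only [sum_mul_controlScore lam s m
        (fun x => P.real (pop.cell s x) / P.real (pop.cell ⊤ x))]
      by_cases h : pop.cohort ω = ⊤ <;> simp [obs, DeltaY, mul_pow, h]
    · rw [integral_const_mul, hmoments.setIntegral_DeltaY_sub_sq, ← hm, sigmaSq]
      ring

theorem integral_influence {m : 𝒳 → ℝ}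
    (hm : ∀ x, m x = ∫ ω, pop.DeltaY lam s ω ∂P[|pop.cell ⊤ x])
    (hms : ∀ x, P (pop.cell s x) ≠ 0 →
      ∫ ω, pop.DeltaY lam s ω ∂P[|pop.cell s x] = m x + pop.catt P lam s x) (r : 𝒳 → ℝ) (p : ℝ) :
    ∫ ω, influence lam s m r (pop.att P lam s) p (pop.obs ω) ∂P = 0 := by
  have hi (x : 𝒳) : Integrable (fun ω => r x * controlScore lam s m x (pop.obs ω)) P :=
    ((hmoments.memLp_controlScore m x).integrable one_le_two).const_mul _
  simp_rw [influence]
  rw [integral_const_mul, integral_sub ((hmoments.memLp_treatedScore m _).integrable one_le_two)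
    (integrable_finsetSum _ fun x _ => hi x), integral_finsetSum _ fun x _ => hi x,
    integral_treatedScore hmoments hms]
  simp [integral_const_mul, integral_controlScore hmoments hm]

end ScoreMoments

/-! ### Asymptotic normality. -/

section LargeSample

variable {Ω' : Type*} [MeasurableSpace Ω'] {P' : Measure Ω'} [IsProbabilityMeasure P']
  {W : ℕ → Ω' → Obs T 𝒳}

omit [Fintype 𝒳] [DecidableEq 𝒳] [MeasurableSingletonClass 𝒳] [IsProbabilityMeasure P'] in
theorem IsRandomSample.ae_tendsto_cohortCount (h : pop.IsRandomSample P P' W) (g : Cohort T) :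
    ∀ᵐ ω ∂P', Tendsto (fun n : ℕ => (n : ℝ)⁻¹ * cohortCount (fun k => W k ω) n g) atTop
      (𝓝 (pop.p P g)) := by
  have hf (ω : Ω) : (if (pop.obs ω).2.1 = g then (1 : ℝ) else 0)
      = (pop.cohortEvent g).indicator 1 ω := by
    by_cases hω : pop.cohort ω = g <;> simp [obs, cohortEvent, hω]
  have := ae_tendsto_sample_mean h.1 h.2 (measurable_ite_cohort g) (by
      simp_rw [hf]
      exact (integrable_const (1 : ℝ)).indicator (pop.measurableSet_cohortEvent g))
  simp_rw [hf] at this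
  rwa [integral_indicator_one (pop.measurableSet_cohortEvent g)] at this

omit [Fintype 𝒳] [IsProbabilityMeasure P'] in
theorem IsRandomSample.ae_tendsto_cellCount (h : pop.IsRandomSample P P' W) (g : Cohort T)
    (x : 𝒳) :
    ∀ᵐ ω ∂P', Tendsto (fun n : ℕ => (n : ℝ)⁻¹ * cellCount (fun k => W k ω) n g x) atTop
      (𝓝 (P.real (pop.cell g x))) := by
  have hf (ω : Ω) : (if (pop.obs ω).2.1 = g then (1 : ℝ) else 0)
      * (if (pop.obs ω).2.2 = x then 1 else 0) = (pop.cell g x).indicator 1 ω := by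
    by_cases h1 : pop.cohort ω = g <;> by_cases h2 : pop.X ω = x <;> simp [obs, cell, h1, h2]
  have := ae_tendsto_sample_mean h.1 h.2
    ((measurable_ite_cohort g).mul (measurable_ite_covariate x)) (by
      simp_rw [Pi.mul_apply, hf]
      exact (integrable_const (1 : ℝ)).indicator (pop.measurableSet_cell g x))
  simp_rw [Pi.mul_apply, hf] at this
  rwa [integral_indicator_one (pop.measurableSet_cell g x)] at this

omit [Fintype 𝒳] [IsProbabilityMeasure P] [IsProbabilityMeasure P'] in
theorem IsRandomSample.ae_cellCount_eq_zero (h : pop.IsRandomSample P P' W) {g : Cohort T}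
    {x : 𝒳} (hx : P (pop.cell g x) = 0) :
    ∀ᵐ ω ∂P', ∀ n, cellCount (fun k => W k ω) n g x = 0 := by
  have hset : MeasurableSet {o : Obs T 𝒳 | ¬ (o.2.1 = g ∧ o.2.2 = x)} :=
    (((measurable_fst.comp measurable_snd) (measurableSet_singleton g)).inter
      ((measurable_snd.comp measurable_snd) (measurableSet_singleton x))).compl
  have h' : ∀ᵐ ω ∂P', ∀ i, ¬ ((W i ω).2.1 = g ∧ (W i ω).2.2 = x) := by
    rw [ae_all_iff]
    intro i
    refine (h.2 i).symm.ae_snd hset ?_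
    rw [ae_iff]
    simpa [obs, cell] using hx
  filter_upwards [h'] with ω hω n
  refine Finset.sum_eq_zero fun i _ => ?_
  by_cases h1 : (W i ω).2.1 = g
  · have h2 : (W i ω).2.2 ≠ x := fun h2 => hω i ⟨h1, h2⟩
    simp [h2]
  · simp [h1]

omit [Fintype 𝒳] [IsProbabilityMeasure P'] in
/-- The ratio of cell counts converges, also for cells of probability zero. -/
theorem IsRandomSample.ae_tendsto_cellCount_div (h : pop.IsRandomSample P P' W)
    (hoverlap : pop.Overlap P) (s : Cohort T) (x : 𝒳) :
    ∀ᵐ ω ∂P', (∀ᶠ n in atTop, cellCount (fun k => W k ω) n ⊤ x = 0 →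
        cellCount (fun k => W k ω) n s x = 0) ∧
      Tendsto (fun n => cellCount (fun k => W k ω) n s x / cellCount (fun k => W k ω) n ⊤ x) atTop
        (𝓝 (P.real (pop.cell s x) / P.real (pop.cell ⊤ x))) := by
  by_cases hx : P (pop.cell ⊤ x) = 0
  -- Common support makes the cohort-s cell null as well, so its counts are almost surely 0 and both
  -- ratio and limit are 0.
  · have hsx : P (pop.cell s x) = 0 :=
      measure_mono_null (fun ω hω => hω.2) (hoverlap.measure_covariate_eq_zero hx)
    filter_upwards [h.ae_cellCount_eq_zero hsx] with ω hω
    simp [hω, measureReal_def, hsx]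
  · have hx' : P.real (pop.cell ⊤ x) ≠ 0 := (measureReal_ne_zero_iff).2 hx
    filter_upwards [h.ae_tendsto_cellCount s x, h.ae_tendsto_cellCount ⊤ x] with ω h1 h2
    constructor
    · filter_upwards [h2.eventually_ne hx'] with n hn h0
      simp [h0] at hn
    · refine (h1.div h2 hx').congr' ?_
      filter_upwards [eventually_gt_atTop 0] with n hn
      have : (n : ℝ)⁻¹ ≠ 0 := by positivity
      exact mul_div_mul_left _ _ this

theorem IsRandomSample.tendstoInDistribution_tauDisc (hsample : pop.IsRandomSample P P' W)
    (hanticip : pop.NoAnticipation P) (htrends : pop.ParallelTrends P)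
    (hoverlap : pop.Overlap P) (hmoments : pop.BoundedFourthMoments P) {s : Fin T}
    (hs : 0 < pop.p P s) {lam : Fin T → ℝ} (hlam : ∀ t, lam t = 0 ∨ lam t = 1)
    (hpost : ∃ t, s ≤ t ∧ lam t = 1) (hpre : ∃ t, t < s ∧ lam t = 1) :
    TendstoInDistribution
      (fun (n : ℕ) (ω : Ω') =>
        Real.sqrt n * (tauDisc (fun k => W k ω) n lam s - pop.att P lam s))
      atTop (id : ℝ → ℝ) (fun _ => P') (gaussianReal 0 (pop.VSEB P lam s).toNNReal) := by
  obtain ⟨m, hm⟩ : ∃ m : 𝒳 → ℝ, ∀ x, m x = ∫ ω, pop.DeltaY lam s ω ∂P[|pop.cell ⊤ x] :=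
    ⟨_, fun _ => rfl⟩
  have hms (x : 𝒳) (hx : P (pop.cell s x) ≠ 0) :
      ∫ ω, pop.DeltaY lam s ω ∂P[|pop.cell s x] = m x + pop.catt P lam s x := by
    rw [hm]
    refine integral_DeltaY_cell hanticip htrends hmoments hlam hpost hpre hx fun h0 => hx ?_
    exact measure_mono_null (fun ω hω => hω.2) (hoverlap.measure_covariate_eq_zero h0)
  have hW (i : ℕ) : AEMeasurable (W i) P' := (hsample.2 i).aemeasurable_fst
  let θ := pop.att P lam s
  let r : 𝒳 → ℝ := fun x => P.real (pop.cell s x) / P.real (pop.cell ⊤ x)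
  let ψ := influence lam s m r θ (pop.p P s)
  have hψL2 : MemLp (fun ω => ψ (pop.obs ω)) 2 P := hmoments.memLp_influence m r θ _
  have hψ0 : ∫ ω, ψ (pop.obs ω) ∂P = 0 := integral_influence hmoments hm hms r _
  have hψm : Measurable ψ := measurable_influence lam s m r θ _
  have hψvar : variance (fun ω => ψ (pop.obs ω)) P = pop.VSEB P lam s := by
    have hψae : AEMeasurable (fun ω => ψ (pop.obs ω)) P :=
      (hψm.comp pop.measurable_obs).aemeasurable
    rw [variance_of_integral_eq_zero hψae hψ0]
    exact integral_influence_sq hmoments hm hms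
  have hclt := tendstoInDistribution_sample_sum hsample.1 hsample.2 hψm hψL2 hψ0
  rw [hψvar] at hclt
  -- Coefficient errors, paired with the scaled sums `Z`: `none` indexes the treated sum, `some x`
  -- the never-treated cell x. The sign is reversed for the latter because controls enter
  -- negatively.
  let A : Option 𝒳 → ℕ → Ω' → ℝ
    | none => fun n ω => (n : ℝ) / cohortCount (fun k => W k ω) n s - 1 / pop.p P s
    | some x => fun n ω => 1 / pop.p P s * r x - (n : ℝ) / cohortCount (fun k => W k ω) n s *
        (cellCount (fun k => W k ω) n s x / cellCount (fun k => W k ω) n ⊤ x)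
  let Z : Option 𝒳 → ℕ → Ω' → ℝ
    | none => fun n ω => (√n)⁻¹ * ∑ i ∈ Finset.range n, treatedScore lam s m θ (W i ω)
    | some x => fun n ω => (√n)⁻¹ * ∑ i ∈ Finset.range n, controlScore lam s m x (W i ω)
  have hN (n : ℕ) := aemeasurable_cohortCount hW n (s : Cohort T)
  have hNinv : ∀ᵐ ω ∂P', Tendsto (fun n : ℕ => (n : ℝ) / cohortCount (fun k => W k ω) n s) atTop
      (𝓝 (1 / pop.p P s)) := by
    filter_upwards [hsample.ae_tendsto_cohortCount (s : Cohort T)] with ω hω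
    simpa [div_eq_mul_inv, mul_comm] using hω.inv₀ hs.ne'
  have hAm (j : Option 𝒳) (n : ℕ) : AEMeasurable (A j n) P' := by
    cases j with
    | none => exact ((hN n).const_div _).sub_const _
    | some x => exact (((hN n).const_div _).mul ((aemeasurable_cellCount hW n s x).div
        (aemeasurable_cellCount hW n ⊤ x))).const_sub _
  have hA0 (j : Option 𝒳) : ∀ᵐ ω ∂P', Tendsto (fun n => A j n ω) atTop (𝓝 0) := by
    cases j with
    | none =>
      filter_upwards [hNinv] with ω hω
      simpa only [sub_self] using hω.sub_const (1 / pop.p P s)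
    | some x =>
      filter_upwards [hNinv, hsample.ae_tendsto_cellCount_div hoverlap s x] with ω h1 h2
      have h3 := (h1.mul h2.2).const_sub (1 / pop.p P s * r x)
      rwa [sub_self] at h3
  have hZ (j : Option 𝒳) : ∃ v, TendstoInDistribution (Z j) atTop (id : ℝ → ℝ) (fun _ => P')
      (gaussianReal 0 v) := by
    cases j with
    | none => exact ⟨_, tendstoInDistribution_sample_sum hsample.1 hsample.2
        (measurable_treatedScore lam s m θ) (hmoments.memLp_treatedScore m θ)
        (integral_treatedScore hmoments hms)⟩
    | some x => exact ⟨_, tendstoInDistribution_sample_sum hsample.1 hsample.2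
        (measurable_controlScore lam s m x) (hmoments.memLp_controlScore m x)
        (integral_controlScore hmoments hm x)⟩
  -- The decomposition into the CLT sum plus ∑ A · Z needs N_s ≠ 0 and a never-treated unit in every
  -- cell that cohort `s` occupies; almost surely this holds for all large n.
  refine tendstoInDistribution_of_ae_eventually_eq
    (tendstoInDistribution_add_sum_mul Finset.univ hclt hAm hA0 hZ)
    (fun n => ((aemeasurable_tauDisc hW n lam s).sub_const _).const_mul _) ?_
  filter_upwards [hsample.ae_tendsto_cohortCount (s : Cohort T),
    ae_all_iff.2 fun x => hsample.ae_tendsto_cellCount_div hoverlap s x] with ω h1 h2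
  filter_upwards [h1.eventually_ne hs.ne', eventually_all.2 fun x => (h2 x).1] with n hn hx
  -- As `0⁻¹ = 0`, a nonzero n⁻¹ · N_s forces both factors to be nonzero.
  have hn0 : n ≠ 0 := fun h => by simp [h] at hn
  have hN0 : cohortCount (fun k => W k ω) n s ≠ 0 := fun h => by simp [h] at hn
  have hsqrt : √(n : ℝ) ≠ 0 := by positivity
  have hnn : (n : ℝ) = √n * √n := (Real.mul_self_sqrt (Nat.cast_nonneg n)).symm
  have hbase : ∑ i ∈ Finset.range n, ψ (W i ω) = 1 / pop.p P s *
      (∑ i ∈ Finset.range n, treatedScore lam s m θ (W i ω)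
        - ∑ x, r x * ∑ i ∈ Finset.range n, controlScore lam s m x (W i ω)) := by
    simp only [ψ, influence, ← Finset.mul_sum, Finset.sum_sub_distrib]
    rw [Finset.sum_comm]
    simp only [← Finset.mul_sum]
  rw [tauDisc_sub_eq (fun k => W k ω) n lam s m (pop.att P lam s) hN0 hx, hbase,
    Fintype.sum_option]
  change √n * (1 / cohortCount (fun k => W k ω) n s
      * (∑ i ∈ Finset.range n, treatedScore lam s m θ (W i ω)
        - ∑ x, cellCount (fun k => W k ω) n s x / cellCount (fun k => W k ω) n ⊤ x
          * ∑ i ∈ Finset.range n, controlScore lam s m x (W i ω))) = _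
  have hsome : ∑ x, A (some x) n ω * Z (some x) n ω
      = (√n)⁻¹ * (1 / pop.p P s)
          * ∑ x, r x * ∑ i ∈ Finset.range n, controlScore lam s m x (W i ω)
        - (√n)⁻¹ * (n / cohortCount (fun k => W k ω) n s)
          * ∑ x, cellCount (fun k => W k ω) n s x / cellCount (fun k => W k ω) n ⊤ x
            * ∑ i ∈ Finset.range n, controlScore lam s m x (W i ω) := by
    rw [Finset.mul_sum, Finset.mul_sum, ← Finset.sum_sub_distrib]
    refine Finset.sum_congr rfl fun x _ => ?_
    simp only [A, Z]
    ring
  have hcoef : (√(n : ℝ))⁻¹ * (n / cohortCount (fun k => W k ω) n s)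
      = √n * (1 / cohortCount (fun k => W k ω) n s) := by
    rw [hnn, Real.sqrt_mul_self (Real.sqrt_nonneg _)]
    field_simp
  rw [hsome, hcoef]
  have hnone : A none n ω * Z none n ω
      = ((√(n : ℝ))⁻¹ * (n / cohortCount (fun k => W k ω) n s) - (√n)⁻¹ * (1 / pop.p P s))
        * ∑ i ∈ Finset.range n, treatedScore lam s m θ (W i ω) := by
    simp only [A, Z]
    ring
  rw [hnone, hcoef]
  ring

end LargeSample

end Population

end DiscreteDiD

open DiscreteDiD in
theorem proposition6
    {T : ℕ} {𝒳 : Type*} [Finite 𝒳] [DecidableEq 𝒳] [MeasurableSpace 𝒳]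
    [MeasurableSingletonClass 𝒳]
    {Ω : Type*} [MeasurableSpace Ω] (P : Measure Ω) [IsProbabilityMeasure P]
    {Ω' : Type*} [MeasurableSpace Ω'] (P' : Measure Ω') [IsProbabilityMeasure P']
    (pop : Population T 𝒳 Ω) (W : ℕ → Ω' → Obs T 𝒳)
    (hfirst : pop.NoneTreatedFirst P)
    (hanticip : pop.NoAnticipation P)
    (htrends : pop.ParallelTrends P)
    (hoverlap : pop.Overlap P)
    (hsample : pop.IsRandomSample P P' W)
    (hmoments : pop.BoundedFourthMoments P)
    (hvar : pop.PositiveVariances P)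
    (s : Fin T) (hs : 0 < pop.p P s)
    (lam : Fin T → ℝ) (hlam : ∀ t, lam t = 0 ∨ lam t = 1)
    (hpost : ∃ t, s ≤ t ∧ lam t = 1) (hpre : ∃ t, t < s ∧ lam t = 1) :
    (∀ (n : ℕ) (ω : Ω'),
        (∀ i < n, (W i ω).2.1 = (s : Cohort T) → (exactMatches (fun k => W k ω) n i).Nonempty) →
        tauDisc (fun k => W k ω) n lam s = tauExactMatch (fun k => W k ω) n lam s) ∧
    0 ≤ pop.VSEB P lam s ∧
    TendstoInDistribution
      (fun (n : ℕ) (ω : Ω') =>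
        Real.sqrt n * (tauDisc (fun k => W k ω) n lam s - pop.att P lam s))
      atTop (id : ℝ → ℝ) (fun _ => P') (gaussianReal 0 (pop.VSEB P lam s).toNNReal) := by
  cases nonempty_fintype 𝒳
  exact ⟨fun n ω _ => tauDisc_eq_tauExactMatch (fun k => W k ω) n lam s, pop.VSEB_nonneg lam s,
    hsample.tendstoInDistribution_tauDisc hanticip htrends hoverlap hmoments hs hlam hpost hpre⟩
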